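/- Let $G$ be a finite simple graph and let $p$ be a real number with $0<p\le 1$. In the \emph{fractional brushing game} with parameter $p$ on $G$, all vertices are initially dirty and carry no brushes. Two players, Min and Max, alternate turns, Min moving first; on each turn the player to move adds one brush to a dirty vertex. Whenever a dirty vertex holds at least $p$ times as many brushes as it has dirty neighbours, it fires: it sends $p$ brushes to each of its dirty neighbours and becomes clean. Firing continues until no dirty vertex can fire (in particular, isolated vertices become clean before the first turn), and then the next turn begins. The game ends when all vertices are clean; Min wants to minimize and Max wants to maximize the number of turns. Let $b_{g,p}(G)$ be the number of turns under optimal play, and let $b_g(G)=b_{g,1}(G)$, the length of the ordinary brushing game (the \emph{game brush number}). \textbf{Theorem.} For every $n$-vertex graph $G$ and every $p=p(n)\in(0,1]$, $$b_{g,p}(G)=(1+o(1))\,p\,b_g(G)+O(n\ln n)\qquad (n\to\infty),$$ uniformly in $G$ and $p$. That is, there are a constant $C$ and a function $\varepsilon:\mathbb N\to\mathbb R$ with $\varepsilon(n)\to 0$ such that for every $n$, every graph $G$ on $n$ vertices and every $p\in(0,1]$ there are reals $\delta,e$ with $|\delta|\le\varepsilon(n)$, $|e|\le C\,n\ln n$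 and $b_{g,p}(G)=(1+\delta)\,p\,b_g(G)+e$. -/

import Mathlib

noncomputable section

open scoped Classical

/-- A position of the brushing game: the set of dirty vertices, and the number of brushes
on each vertex (a real number, since in the fractional game brushes are split). -/
structure BrushState (V : Type*) where
  dirty : Finset V
  brushes : V → ℝ

namespace BrushState

variable {V : Type*}

/-- The dirty neighbours of `v`. -/
def dirtyNbrs (G : SimpleGraph V) (s : BrushState V) (v : V) : Finset V :=
  s.dirty.filter fun u => G.Adj v u

/-- A dirty vertex is ready to fire when it holds at least `p` times as many brushes as it has
dirty neighbours. -/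
def Ready (p : ℝ) (G : SimpleGraph V) (s : BrushState V) (v : V) : Prop :=
  v ∈ s.dirty ∧ p * ((s.dirtyNbrs G v).card : ℝ) ≤ s.brushes v

/-- Firing `v`: it sends `p` brushes to each of its dirty neighbours and becomes clean. -/
def fire (p : ℝ) (G : SimpleGraph V) (s : BrushState V) (v : V) : BrushState V where
  dirty := s.dirty.erase v
  brushes := fun u =>
    if u = v then s.brushes u - p * ((s.dirtyNbrs G v).card : ℝ)
    else if u ∈ s.dirtyNbrs G v then s.brushes u + p
    else s.brushes u

/-- Fire ready vertices, one at a time and in an arbitrary order, until none is left. -/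
def stabilize (p : ℝ) (G : SimpleGraph V) (s : BrushState V) : BrushState V :=
  if h : ∃ v, s.Ready p G v then stabilize p G (s.fire p G h.choose) else s
termination_by s.dirty.card
decreasing_by exact Finset.card_erase_lt_of_mem h.choose_spec.1

/-- Put one more brush on `v`. -/
def place (s : BrushState V) (v : V) : BrushState V where
  dirty := s.dirty
  brushes := Function.update s.brushes v (s.brushes v + 1)

/-- A turn: one brush is placed on `v`, and then vertices fire until the position is stable. -/
def play (p : ℝ) (G : SimpleGraph V) (s : BrushState V) (v : V) : BrushState V :=
  (s.place v).stabilize p G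

/-- The starting position: all vertices are dirty and there are no brushes. (Vertices which are
ready at once, that is isolated ones, fire before the first turn.) -/
def start (p : ℝ) (G : SimpleGraph V) [Fintype V] : BrushState V :=
  stabilize p G ⟨Finset.univ, fun _ => 0⟩

end BrushState

/-- The two players. -/
inductive BrushPlayer
  | Min
  | Max

/-- `EndsWithin p G k P s`: from the position `s`, with player `P` to move, Min can guarantee
that all vertices are clean after at most `k` further turns. On each turn the player to move
chooses a dirty vertex. -/
def EndsWithin {V : Type*} (p : ℝ) (G : SimpleGraph V) :
    ℕ → BrushPlayer → BrushState V → Prop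
  | 0, _, s => s.dirty = ∅
  | k + 1, BrushPlayer.Min, s =>
      s.dirty = ∅ ∨ ∃ v ∈ s.dirty, EndsWithin p G k BrushPlayer.Max (s.play p G v)
  | k + 1, BrushPlayer.Max, s =>
      s.dirty = ∅ ∨ ∀ v ∈ s.dirty, EndsWithin p G k BrushPlayer.Min (s.play p G v)

/-- The length, under optimal play, of the Min-start fractional brushing game with
parameter `p` on `G`. -/
def fracGameBrushNumber {V : Type*} [Fintype V] (p : ℝ) (G : SimpleGraph V) : ℕ :=
  sInf {k | EndsWithin p G k BrushPlayer.Min (BrushState.start p G)}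

/-- The game brush number of `G`: the length, under optimal play, of the ordinary Min-start
brushing game, in which a vertex fires when it has at least as many brushes as dirty neighbours
and then sends one brush to each of them. -/
def gameBrushNumber {V : Type*} [Fintype V] (G : SimpleGraph V) : ℕ :=
  fracGameBrushNumber 1 G

/-! The game always ends, so the infimum above is attained and is never a default value. -/

namespace BrushState

variable {V : Type*}

lemma stabilize_dirty_subset (p : ℝ) (G : SimpleGraph V) (s : BrushState V) :
    (s.stabilize p G).dirty ⊆ s.dirty := by
  induction s using stabilize.induct p G with
  | case1 s h ih =>
    rw [stabilize, dif_pos h]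
    exact ih.trans (Finset.erase_subset _ _)
  | case2 s h => rw [stabilize, dif_neg h]

lemma stabilize_card_lt (p : ℝ) (G : SimpleGraph V) (s : BrushState V)
    (h : ∃ v, s.Ready p G v) : (s.stabilize p G).dirty.card < s.dirty.card := by
  rw [stabilize, dif_pos h]
  exact (Finset.card_le_card (stabilize_dirty_subset p G _)).trans_lt
    (Finset.card_erase_lt_of_mem h.choose_spec.1)

end BrushState

lemma EndsWithin.succ {V : Type*} {p : ℝ} {G : SimpleGraph V} {k : ℕ} :
    ∀ {P : BrushPlayer} {s : BrushState V}, EndsWithin p G k P s → EndsWithin p G (k + 1) P s := by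
  induction k with
  | zero => intro P s h; cases P <;> exact Or.inl h
  | succ k ih =>
    intro P s h
    cases P with
    | Min => exact h.imp id fun ⟨v, hv, h⟩ => ⟨v, hv, ih h⟩
    | Max => exact h.imp id fun h v hv => ih (h v hv)

lemma EndsWithin.mono {V : Type*} {p : ℝ} {G : SimpleGraph V} {k l : ℕ} (hkl : k ≤ l)
    {P : BrushPlayer} {s : BrushState V} (h : EndsWithin p G k P s) : EndsWithin p G l P s := by
  induction hkl with
  | refl => exact h
  | step _ ih => exact ih.succ

lemma exists_endsWithin {V : Type*} {p : ℝ} (hp : 0 ≤ p) (G : SimpleGraph V) :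
    ∀ (d m : ℕ) (P : BrushPlayer) (s : BrushState V), s.dirty.card ≤ d →
      (∑ v ∈ s.dirty, ⌈p * d - s.brushes v⌉₊) ≤ m → ∃ k, EndsWithin p G k P s := by
  intro d
  induction d with
  | zero =>
    intro m P s hs _
    exact ⟨0, Finset.card_eq_zero.mp (Nat.le_zero.mp hs)⟩
  | succ d ihd =>
    intro m
    induction m using Nat.strong_induction_on with
    | _ m ihm =>
    intro P s hs hm
    have key : ∀ (Q : BrushPlayer), ∀ v ∈ s.dirty, ∃ k, EndsWithin p G k Q (s.play p G v) := by
      intro Q v hv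
      by_cases h : ∃ u, (s.place v).Ready p G u
      · refine ihd _ Q _ ?_ le_rfl
        have := BrushState.stabilize_card_lt p G (s.place v) h
        have h2 : (s.place v).dirty = s.dirty := rfl
        rw [h2] at this
        unfold BrushState.play
        omega
      · have hplay : s.play p G v = s.place v := by
          rw [BrushState.play, BrushState.stabilize, dif_neg h]
        rw [hplay]
        have hnr : s.brushes v + 1 < p * (d + 1 : ℕ) := by
          have h1 : ¬ (s.place v).Ready p G v := fun h' => h ⟨v, h'⟩
          have h2 : s.brushes v + 1 < p * (((s.place v).dirtyNbrs G v).card : ℝ) := by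
            by_contra hc
            exact h1 ⟨hv, by simpa [BrushState.place] using not_lt.mp hc⟩
          refine h2.trans_le (mul_le_mul_of_nonneg_left ?_ hp)
          exact_mod_cast (Finset.card_le_card (Finset.filter_subset _ _)).trans hs
        have hlt : (∑ u ∈ s.dirty, ⌈p * (d + 1 : ℕ) - (s.place v).brushes u⌉₊)
            < ∑ u ∈ s.dirty, ⌈p * (d + 1 : ℕ) - s.brushes u⌉₊ := by
          refine Finset.sum_lt_sum (fun u _ => Nat.ceil_mono ?_) ⟨v, hv, ?_⟩
          · by_cases huv : u = v
            · subst huv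
              simp only [BrushState.place, Function.update_self]
              linarith
            · simp [BrushState.place, huv]
          · have : (s.place v).brushes v = s.brushes v + 1 := by simp [BrushState.place]
            rw [this, Nat.lt_ceil]
            have := Nat.ceil_lt_add_one (a := p * (d + 1 : ℕ) - (s.brushes v + 1)) (by linarith)
            linarith
        exact ihm _ (hlt.trans_le hm) Q _ hs le_rfl
    by_cases he : s.dirty = ∅
    · exact ⟨0, he⟩
    obtain ⟨v, hv⟩ := Finset.nonempty_iff_ne_empty.mpr he
    cases P with
    | Min =>
      obtain ⟨k, hk⟩ := key BrushPlayer.Max v hv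
      exact ⟨k + 1, Or.inr ⟨v, hv, hk⟩⟩
    | Max =>
      choose! f hf using key BrushPlayer.Min
      exact ⟨s.dirty.sup f + 1, Or.inr fun u hu => (hf u hu).mono (Finset.le_sup hu)⟩

lemma endsWithin_fracGameBrushNumber {V : Type*} [Fintype V] {p : ℝ} (hp : 0 ≤ p)
    (G : SimpleGraph V) :
    EndsWithin p G (fracGameBrushNumber p G) BrushPlayer.Min (BrushState.start p G) := by
  have h : {k | EndsWithin p G k BrushPlayer.Min (BrushState.start p G)}.Nonempty :=
    exists_endsWithin hp G _ _ _ _ le_rfl le_rfl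
  exact Nat.sInf_mem h

end

/-! ### The placement game on abstract loads -/

section AbstractGame

open scoped Classical

variable {V : Type*}

/-! Firing is order-independent: measured in units of `p`, the loads `x` placed so far determine the
dirty set, namely the largest set in which every vertex has load plus degree below twice its number
of neighbours in the set. This map does not involve `p`, so `p` enters only through the step `1/p`
added per turn (`endsWithin_start_iff`).

It remains to compare steps `g` and `h = g * k`. In each direction Min imitates a strategy for the
other step, treating one long move as `k` short moves on the same vertex. The other moves made
meanwhile are scattered; in long units they pour at most one unit into cups, one cup per vertex.
Playing on the fullest cup removes one unit, and the classical cup-emptying argument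
(`cupsBalanced_remove`) confines the discrepancy to `O(ln n)` per vertex, hence `O(n ln n)` long
turns in total (`clearsWithin_long`, `clearsWithin_short`).

For rational `p = a / b`, parameters `p` and `1` are both compared with the integer parameter `a`.
Monotonicity in `p` then gives all real `p`. -/

/-- Add `h` to the value of `x` at `v`. -/
noncomputable def bump (x : V → ℝ) (v : V) (h : ℝ) : V → ℝ :=
  fun w => x w + if w = v then h else 0

lemma le_bump (x : V → ℝ) (v : V) {h : ℝ} (hh : 0 ≤ h) (w : V) : x w ≤ bump x v h w := by
  unfold bump
  split_ifs <;> linarith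

/-- A map assigning to each load the set of dirty vertices: the dirty set depends only on the
loads of the dirty vertices, and lowering these can only enlarge it. -/
def IsDirtyMap (D : (V → ℝ) → Finset V) : Prop :=
  ∀ x y : V → ℝ, (∀ v ∈ D y, x v ≤ y v) → D y ⊆ D x

lemma IsDirtyMap.bump_subset {D : (V → ℝ) → Finset V} (hD : IsDirtyMap D) (x : V → ℝ) (v : V)
    {h : ℝ} (hh : 0 ≤ h) : D (bump x v h) ⊆ D x :=
  hD _ _ fun w _ => le_bump x v hh w

/-- The game in which the players alternately add `h` to the load of a dirty vertex:
Min, with player `P` to move, can reach an empty dirty set within `k` turns. -/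
def ClearsWithin (D : (V → ℝ) → Finset V) (h : ℝ) : ℕ → BrushPlayer → (V → ℝ) → Prop
  | 0, _, x => D x = ∅
  | k + 1, BrushPlayer.Min, x =>
      D x = ∅ ∨ ∃ v ∈ D x, ClearsWithin D h k BrushPlayer.Max (bump x v h)
  | k + 1, BrushPlayer.Max, x =>
      D x = ∅ ∨ ∀ v ∈ D x, ClearsWithin D h k BrushPlayer.Min (bump x v h)

namespace ClearsWithin

variable {D : (V → ℝ) → Finset V} {g h : ℝ}

lemma of_empty {k : ℕ} {P : BrushPlayer} {x : V → ℝ} (hx : D x = ∅) :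
    ClearsWithin D h k P x := by
  cases k with
  | zero => exact hx
  | succ k => cases P <;> exact Or.inl hx

lemma succ {k : ℕ} : ∀ {P : BrushPlayer} {x : V → ℝ},
    ClearsWithin D h k P x → ClearsWithin D h (k + 1) P x := by
  induction k with
  | zero => intro P x hx; exact of_empty hx
  | succ k ih =>
    intro P x hx
    cases P with
    | Min => exact hx.imp id fun ⟨v, hv, h⟩ => ⟨v, hv, ih h⟩
    | Max => exact hx.imp id fun h v hv => ih (h v hv)

lemma mono {k l : ℕ} (hkl : k ≤ l) {P : BrushPlayer} {x : V → ℝ}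
    (hx : ClearsWithin D h k P x) : ClearsWithin D h l P x := by
  induction hkl with
  | refl => exact hx
  | step _ ih => exact ih.succ

/-- Larger loads on the dirty vertices and larger steps can only help Min. -/
lemma of_load_le (hD : IsDirtyMap D) (hg : 0 ≤ g) (hgh : g ≤ h) {k : ℕ} :
    ∀ {P : BrushPlayer} {x y : V → ℝ}, (∀ v ∈ D y, x v ≤ y v) →
      ClearsWithin D g k P x → ClearsWithin D h k P y := by
  have hh : 0 ≤ h := hg.trans hgh
  induction k with
  | zero =>
    intro P x y hxy hx
    exact Finset.subset_empty.mp ((hD _ _ hxy).trans (show D x ⊆ ∅ from hx.le))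
  | succ k ih =>
    intro P x y hxy hx
    have hsub := hD _ _ hxy
    by_cases hy : D y = ∅
    · exact of_empty hy
    have step : ∀ v, ∀ w ∈ D (bump y v h), bump x v g w ≤ bump y v h w := by
      intro v w hw
      have := hxy w (hD.bump_subset y v hh hw)
      unfold bump
      split_ifs <;> linarith
    cases P with
    | Max =>
      refine Or.inr fun v hv => ?_
      rcases hx with hx | hx
      · rw [hx] at hsub
        exact absurd (hsub hv) (Finset.notMem_empty _)
      · exact ih (step v) (hx v (hsub hv))
    | Min =>
      rcases hx with hx | ⟨v, hv, hx⟩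
      · rw [hx] at hsub
        exact absurd (Finset.subset_empty.mp hsub) hy
      by_cases hvy : v ∈ D y
      · exact Or.inr ⟨v, hvy, ih (step v) hx⟩
      -- The prescribed vertex is already clean in `y`, so its load no longer matters and any dirty
      -- vertex serves.
      · obtain ⟨u, hu⟩ := Finset.nonempty_iff_ne_empty.mpr hy
        refine Or.inr ⟨u, hu, ih (fun w hw => ?_) hx⟩
        have hw' := hD.bump_subset y u hh hw
        have hwv : w ≠ v := fun e => hvy (e ▸ hw')
        have h1 := hxy w hw'
        have h2 := le_bump y u hh w
        have h3 : bump x v g w = x w := by simp [bump, hwv]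
        linarith

/-- An extra move never hurts Min, so handing him the turn costs one turn. -/
lemma min_of_max (hD : IsDirtyMap D) (hh : 0 ≤ h) {k : ℕ} {x : V → ℝ}
    (hx : ClearsWithin D h k .Max x) : ClearsWithin D h (k + 1) .Min x := by
  by_cases hx0 : D x = ∅
  · exact of_empty hx0
  obtain ⟨u, hu⟩ := Finset.nonempty_iff_ne_empty.mpr hx0
  exact Or.inr ⟨u, hu, of_load_le hD hh le_rfl (fun w _ => le_bump x u hh w) hx⟩

/-- To win within `B + 2 j` turns, Min may spend `j` turns on a vertex `v`. In the meantime Max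
makes `j` moves, recorded by `r`. -/
lemma of_burst [Fintype V] (hD : IsDirtyMap D) (hg : 0 ≤ g) (v : V) {B : ℕ} (j : ℕ) :
    ∀ y : V → ℝ,
      (∀ (y' r : V → ℝ), (∀ w, 0 ≤ r w) → (∀ w, w ∉ D y → r w = 0) → ∑ w, r w = j →
        (∀ w ∈ D y', y w + (if w = v then g * j else 0) + g * r w ≤ y' w) →
        ClearsWithin D g B .Min y') →
      ClearsWithin D g (B + 2 * j) .Min y := by
  induction j with
  | zero =>
    intro y H
    exact H y 0 (by simp) (by simp) (by simp) (by simp)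
  | succ j ih =>
    intro y H
    by_cases hy : D y = ∅
    · exact of_empty hy
    -- Once `v` is clean Min may play anywhere, since loads are compared only on dirty vertices.
    obtain ⟨u, hu, huv⟩ : ∃ u ∈ D y, v ∈ D y → u = v := by
      by_cases hv : v ∈ D y
      · exact ⟨v, hv, fun _ => rfl⟩
      · obtain ⟨u, hu⟩ := Finset.nonempty_iff_ne_empty.mpr hy
        exact ⟨u, hu, fun h => absurd h hv⟩
    refine Or.inr ⟨u, hu, Or.inr fun m hm => ih _ fun y' r hr0 hrs hrj hr => ?_⟩
    have hm' := hD.bump_subset y u hg hm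
    have hs1 : D (bump (bump y u g) m g) ⊆ D y :=
      (hD.bump_subset _ _ hg).trans (hD.bump_subset _ _ hg)
    have hs2 : D y' ⊆ D y := by
      refine hD _ _ fun w hw => ?_
      have h1 := hr w hw
      have h2 := le_bump y u hg w
      have h3 := le_bump (bump y u g) m hg w
      have h4 := mul_nonneg hg (hr0 w)
      have h5 : 0 ≤ if w = v then g * (j : ℝ) else 0 := by positivity
      linarith
    refine H y' (fun w => r w + if w = m then 1 else 0) (fun w => ?_) (fun w hw => ?_) ?_
      fun w hw => ?_
    · have := hr0 w
      positivity
    · have hwm : w ≠ m := fun e => hw (e ▸ hm')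
      simp [hwm, hrs w fun h => hw (hs1 h)]
    · simp [Finset.sum_add_distrib, hrj]
    · have h1 := hr w hw
      have h2 : w = v → w = u := fun e => by
        rw [huv (e ▸ hs2 hw), e]
      unfold bump at h1
      push_cast
      by_cases hwv : w = v
      · have hwu := h2 hwv
        simp only [hwv, if_true] at h1 ⊢
        rw [← hwv] at h1 ⊢
        simp only [hwu, if_true] at h1 ⊢
        split_ifs at h1 ⊢ <;> linarith
      · simp only [hwv, if_false] at h1 ⊢
        split_ifs at h1 ⊢ <;> linarith

/-- A brush given to Min for free is worth at most two turns. -/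
lemma of_bump (hD : IsDirtyMap D) (hh : 0 ≤ h) {k : ℕ} {x : V → ℝ} (v : V)
    (hx : ClearsWithin D h k .Min (bump x v h)) : ClearsWithin D h (k + 2) .Min x := by
  by_cases hv : v ∈ D x
  · refine Or.inr ⟨v, hv, ?_⟩
    by_cases h0 : D (bump x v h) = ∅
    · exact of_empty h0
    · exact Or.inr fun u _ => of_load_le hD hh le_rfl (fun w _ => le_bump _ u hh w) hx
  · refine (of_load_le hD hh le_rfl (fun w hw => ?_) hx).mono (by omega)
    have hwv : w ≠ v := fun e => hv (e ▸ hw)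
    simp [bump, hwv]

lemma of_indicator (hD : IsDirtyMap D) (hh : 0 ≤ h) {k : ℕ} (S : Finset V) :
    ∀ {x : V → ℝ}, ClearsWithin D h k .Min (fun w => x w + if w ∈ S then h else 0) →
      ClearsWithin D h (k + 2 * S.card) .Min x := by
  induction S using Finset.induction_on with
  | empty => intro x hx; simpa using hx
  | insert v S hv ih =>
    intro x hx
    rw [Finset.card_insert_of_notMem hv]
    refine of_bump hD hh v (ih (x := bump x v h) ?_)
    convert hx using 2 with w
    unfold bump
    by_cases hwv : w = v
    · subst hwv; simp [hv]
    · simp [hwv]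

lemma of_add_const [Fintype V] (hD : IsDirtyMap D) (hh : 0 ≤ h) {k : ℕ} (L : ℕ) :
    ∀ {x : V → ℝ}, ClearsWithin D h k .Min (fun w => x w + h * L) →
      ClearsWithin D h (k + 2 * Fintype.card V * L) .Min x := by
  induction L with
  | zero => intro x hx; simpa using hx
  | succ L ih =>
    intro x hx
    have := of_indicator (k := k + 2 * Fintype.card V * L) hD hh Finset.univ (x := x)
      (ih (by convert hx using 2 with w; push_cast; simp; ring))
    rw [Finset.card_univ] at this
    convert this using 1
    ring

/-- Min's replies, recorded by `r`, while Max plays `j` times on the vertex `v`, or until `v` is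
clean. -/
lemma exists_replies [Fintype V] (hD : IsDirtyMap D) (hg : 0 ≤ g) {B : ℕ} {y : V → ℝ}
    (hy : ClearsWithin D g B .Max y) (v : V) (j : ℕ) :
    ∃ (B' : ℕ) (y' r : V → ℝ), (∀ w, 0 ≤ r w) ∧ ∑ w, r w ≤ j ∧
      (∀ w, y' w ≤ y w + (if w = v then g * j else 0) + g * r w) ∧ D y' ⊆ D y ∧
      ClearsWithin D g B' .Max y' ∧ (B' + 2 * j ≤ B ∨ (B' ≤ B ∧ v ∉ D y')) := by
  induction j with
  | zero => exact ⟨B, y, 0, by simp, by simp, by simp, subset_rfl, hy, by simp⟩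
  | succ j ih =>
    obtain ⟨B', y', r, hr0, hrj, hr, hs, hc, hB⟩ := ih
    by_cases hv : v ∈ D y'
    swap
    · refine ⟨B', y', r, hr0, hrj.trans (by push_cast; linarith), fun w => (hr w).trans ?_, hs, hc,
        Or.inr ⟨by omega, hv⟩⟩
      push_cast
      split_ifs <;> linarith
    rcases hB with hB | hB
    swap
    · exact absurd hv hB.2
    have hs' := hD.bump_subset y' v hg
    by_cases h0 : D (bump y' v g) = ∅
    · refine ⟨B, bump y' v g, r, hr0, hrj.trans (by push_cast; linarith), fun w => ?_,
        hs'.trans hs, of_empty h0, Or.inr ⟨le_rfl, by simp [h0]⟩⟩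
      have := hr w
      unfold bump
      push_cast
      split_ifs at this ⊢ <;> linarith
    -- A vertex is still dirty after Max's move, so at least two turns remain and Min has a reply.
    match B', hc, hB with
    | 0, hc, _ => exact absurd hv (by rw [show D y' = ∅ from hc]; simp)
    | 1, hc, _ =>
      rcases hc with hc | hc
      · exact absurd hv (by rw [hc]; simp)
      · exact absurd (hc v hv) h0
    | b + 2, hc, hB =>
      rcases hc with hc | hc
      · exact absurd hv (by rw [hc]; simp)
      rcases hc v hv with h1 | ⟨u, hu, hc'⟩
      · exact absurd h1 h0
      refine ⟨b, _, fun w => r w + if w = u then 1 else 0, fun w => ?_, ?_, fun w => ?_,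
        ((hD.bump_subset _ u hg).trans hs').trans hs, hc', Or.inl (by omega)⟩
      · have := hr0 w
        positivity
      · simp [Finset.sum_add_distrib, hrj]
      · have := hr w
        unfold bump
        push_cast
        split_ifs at this ⊢ <;> linarith

end ClearsWithin

end AbstractGame

/-! ### Balance in the cup-emptying game -/

section CupGame

open scoped Classical

variable {V : Type*}

/-- The levels `z` of the cups in `S` are kept low in the sense of the cup emptying game. -/
def CupsBalanced (c : ℝ) (S : Finset V) (z : V → ℝ) : Prop :=
  ∀ A ⊆ S, ∑ v ∈ A, z v ≤ A.card * (c - (harmonic A.card : ℝ))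

lemma CupsBalanced.subset {c : ℝ} {S T : Finset V} {z : V → ℝ} (hz : CupsBalanced c S z) (hT : T ⊆ S) :
    CupsBalanced c T z := fun A hA => hz A (hA.trans hT)

lemma CupsBalanced.le {c : ℝ} {S : Finset V} {z : V → ℝ} (hz : CupsBalanced c S z) {v : V} (hv : v ∈ S) :
    z v ≤ c - 1 := by
  simpa [harmonic] using hz {v} (Finset.singleton_subset_iff.mpr hv)

lemma CupsBalanced.sum_add_le {c : ℝ} {S : Finset V} {z a : V → ℝ} [Fintype V] (hz : CupsBalanced c S z)
    (ha : ∀ v, 0 ≤ a v) (ha1 : ∑ v, a v ≤ 1) (A : Finset V) (hA : A ⊆ S) :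
    ∑ v ∈ A, (z v + a v) ≤ A.card * (c - (harmonic A.card : ℝ)) + 1 := by
  rw [Finset.sum_add_distrib]
  have h1 : ∑ v ∈ A, a v ≤ ∑ v, a v :=
    Finset.sum_le_sum_of_subset_of_nonneg (Finset.subset_univ _) fun v _ _ => ha v
  have := hz A hA
  linarith

/-- After one unit has been poured into the cups, removing one unit from the fullest cup restores
the balance. -/
lemma cupsBalanced_remove {c : ℝ} {S T : Finset V} {z : V → ℝ}
    (hz : ∀ A ⊆ S, ∑ v ∈ A, z v ≤ A.card * (c - (harmonic A.card : ℝ)) + 1) (hT : T ⊆ S)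
    {m : V} (hm : m ∈ T) (hmax : ∀ v ∈ T, z v ≤ z m) :
    CupsBalanced c T fun v => z v - if v = m then 1 else 0 := by
  intro A hA
  rw [Finset.sum_sub_distrib]
  by_cases hmA : m ∈ A
  · have := hz A (hA.trans hT)
    simp only [Finset.sum_ite_eq', hmA, if_true]
    linarith
  -- `m` is at least as full as the cups of `A`, so the average over `A` is at most that over
  -- `insert m A`. The harmonic term absorbs the poured unit exactly.
  · have h1 := hz (insert m A) (Finset.insert_subset (hT hm) (hA.trans hT))
    rw [Finset.sum_insert hmA, Finset.card_insert_of_notMem hmA, harmonic_succ] at h1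
    have h2 : ∑ v ∈ A, z v ≤ A.card * z m := by
      simpa using Finset.sum_le_card_nsmul A z (z m) fun v hv => hmax v (hA hv)
    simp only [Finset.sum_ite_eq', hmA, if_false, sub_zero]
    push_cast at h1
    set j : ℝ := (A.card : ℝ)
    set H : ℝ := (harmonic A.card : ℝ)
    have hj : 0 ≤ j := Nat.cast_nonneg _
    have h3 : (j + 1) * (c - (H + (j + 1)⁻¹)) + 1 = (j + 1) * (c - H) := by
      field_simp
      ring
    rw [h3] at h1
    have h4 : (j + 1) * ∑ v ∈ A, z v ≤ (j + 1) * (j * (c - H)) := by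
      nlinarith [mul_le_mul_of_nonneg_left h1 hj]
    exact le_of_mul_le_mul_left h4 (by linarith)

lemma harmonic_mono {m n : ℕ} (h : m ≤ n) : harmonic m ≤ harmonic n :=
  Finset.sum_le_sum_of_subset_of_nonneg (by simpa using h) fun _ _ _ => by positivity

end CupGame

/-! ### Comparing a step with its integer multiple -/

section Comparison

open scoped Classical

variable {V : Type*} [Fintype V] {D : (V → ℝ) → Finset V} {g h : ℝ} {k : ℕ}

/-- Min, in the game with the long step `h = g * k`, follows a strategy for the short step `g`:
`z` is his debt, measured in long steps, to the position `y` of the game with short steps. -/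
lemma clearsWithin_long_of_debt (hD : IsDirtyMap D) (hg : 0 < g) (hk : 0 < k)
    (hgk : g * k = h) : ∀ (T B : ℕ) (x y z : V → ℝ), ClearsWithin D g B .Max y →
      CupsBalanced 1 (D x) z → (∀ v ∈ D x, y v ≤ x v + h * z v) →
      B + 2 * k * (D y).card ≤ k * T → ClearsWithin D h T .Max x := by
  have hk' : (0 : ℝ) < k := by exact_mod_cast hk
  have hh : 0 < h := hgk ▸ mul_pos hg hk'
  -- Balance with constant 1 makes every debt nonpositive.
  have sub : ∀ x y z : V → ℝ, CupsBalanced 1 (D x) z → (∀ v ∈ D x, y v ≤ x v + h * z v) →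
      D x ⊆ D y := fun x y z hz hyx => hD _ _ fun v hv => by
    have := hz.le hv
    have := hyx v hv
    nlinarith
  intro T
  induction T using Nat.twoStepInduction with
  | zero =>
    intro B x y z hy hz hyx hT
    -- Each dirty vertex weighs `2 * k`, more than the budget allows.
    have hc : (D y).card = 0 := by
      by_contra hc
      have : 0 < 2 * k * (D y).card := by positivity
      omega
    have := sub x y z hz hyx
    rw [Finset.card_eq_zero.mp hc] at this
    exact Finset.subset_empty.mp this
  | one =>
    intro B x y z hy hz hyx hT
    have hc : (D y).card = 0 := by
      by_contra hc
      have : 2 * k * 1 ≤ 2 * k * (D y).card := Nat.mul_le_mul_left _ (by omega)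
      omega
    have := sub x y z hz hyx
    rw [Finset.card_eq_zero.mp hc] at this
    exact Or.inl (Finset.subset_empty.mp this)
  | more T ih _ =>
    intro B x y z hy hz hyx hT
    refine Or.inr fun v hv => ?_
    -- Max's long move becomes `k` short ones in the imagined game; Min's replies there add at most
    -- one long unit of debt.
    obtain ⟨B', y', r, hr0, hrk, hr, hs, hc, hB⟩ := hy.exists_replies hD hg.le v k
    by_cases h0 : D (bump x v h) = ∅
    · exact .of_empty h0
    obtain ⟨m, hm, hmax⟩ := (D (bump x v h)).exists_max_image (fun w => z w + r w / k)
      (Finset.nonempty_iff_ne_empty.mpr h0)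
    have hsx := hD.bump_subset x v hh.le
    have hsm := hD.bump_subset (bump x v h) m hh.le
    refine Or.inr ⟨m, hm, ih B' _ y' _ hc ((cupsBalanced_remove (hz.sum_add_le (a := fun w => r w / k)
      (fun w => div_nonneg (hr0 w) hk'.le) ?_) hsx hm hmax).subset hsm) (fun w hw => ?_) ?_⟩
    · rw [← Finset.sum_div, div_le_one hk']
      exact hrk
    · have h1 := hr w
      have h2 := hyx w (hsx (hsm hw))
      have h3 : h * (r w / k) = g * r w := by rw [← hgk]; field_simp
      unfold bump
      rw [hgk] at h1
      rw [mul_sub, mul_add, h3]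
      split_ifs at h1 ⊢ <;> linarith
    · have hle := Finset.card_le_card hs
      rcases hB with hB | ⟨hB, hv'⟩
      -- Two long turns are paid for either by `2 * k` short turns or by `v` leaving the dirty set
      -- of `y`.
      · have : 2 * k * (D y').card ≤ 2 * k * (D y).card := Nat.mul_le_mul_left _ hle
        nlinarith
      · have hlt : (D y').card + 1 ≤ (D y).card := Finset.card_lt_card
          ⟨hs, fun h => hv' (h (sub x y z hz hyx hv))⟩
        have := Nat.mul_le_mul_left (2 * k) hlt
        nlinarith

lemma clearsWithin_long (hD : IsDirtyMap D) (hg : 0 < g) (hk : 0 < k) (hgk : g * k = h)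
    {L T B : ℕ} (hL : (harmonic (Fintype.card V) : ℝ) ≤ L)
    (hT : B + 2 * k * Fintype.card V ≤ k * T) (hB : ClearsWithin D g B .Min 0) :
    ClearsWithin D h (T + 1 + 2 * Fintype.card V * L) .Min 0 := by
  have hk' : (1 : ℝ) ≤ k := by exact_mod_cast hk
  have hh : 0 < h := hgk ▸ mul_pos hg (by linarith)
  by_cases h0 : D 0 = ∅
  · exact .of_empty h0
  cases B with
  | zero => exact absurd hB h0
  | succ B =>
    rcases hB with hB | ⟨v, -, hB⟩
    · exact absurd hB h0
    refine .of_add_const hD hh.le L (.min_of_max hD hh.le ?_)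
    -- The free load `h * L` permits initial debt `1 - L`, balanced because `L` bounds the harmonic
    -- numbers. The spare unit covers Min's first short move.
    refine clearsWithin_long_of_debt hD hg hk hgk T B _ _ (fun _ => 1 - L) hB (fun A _ => ?_)
      (fun w _ => ?_) ?_
    · have h1 : ((harmonic A.card : ℚ) : ℝ) ≤ harmonic (Fintype.card V) := by
        exact_mod_cast harmonic_mono (Finset.card_le_univ A)
      rw [Finset.sum_const, nsmul_eq_mul]
      exact mul_le_mul_of_nonneg_left (by linarith) (Nat.cast_nonneg _)
    · have h1 : g ≤ h := by nlinarith
      simp only [bump, Pi.zero_apply]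
      split_ifs <;> nlinarith
    · have := Nat.mul_le_mul_left (2 * k) (Finset.card_le_univ (D (bump 0 v g)))
      omega

/-- Min, in the game with the short step `g`, follows a strategy for the long step `h = g * k`:
`c` is his credit, measured in long steps, over the position `x` of the game with long steps. -/
lemma clearsWithin_short_of_credit (hD : IsDirtyMap D) (hg : 0 < g) (hk : 0 < k)
    (hgk : g * k = h) : ∀ (T B : ℕ) (x y c : V → ℝ), ClearsWithin D h T .Min x →
      CupsBalanced (1 + (harmonic (Fintype.card V) : ℝ)) (D x) c → (∀ v ∈ D x, 0 ≤ c v) →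
      (∀ v ∈ D y, x v + h * c v ≤ y v) → D y ⊆ D x →
      k * (T + 1) + 2 * k * ∑ v ∈ D x, ((harmonic (Fintype.card V) : ℝ) + 1 - c v) ≤ (B : ℝ) →
      ClearsWithin D g B .Min y := by
  have hk' : (0 : ℝ) < k := by exact_mod_cast hk
  have hh : 0 < h := hgk ▸ mul_pos hg hk'
  set H : ℝ := (harmonic (Fintype.card V) : ℝ) with hH
  -- the effect of `k` turns spent by Min on `v`
  have burst : ∀ (B : ℕ) (x y c : V → ℝ) (v : V), (∀ v ∈ D x, 0 ≤ c v) →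
      (∀ v ∈ D y, x v + h * c v ≤ y v) → D y ⊆ D x → 2 * k ≤ B →
      (∀ y' a : V → ℝ, (∀ w, 0 ≤ a w) → (∀ w, w ∉ D y → a w = 0) → ∑ w, a w = 1 →
        D y' ⊆ D (bump x v h) →
        (∀ w ∈ D y', bump x v h w + h * (c w + a w) ≤ y' w) →
        ClearsWithin D g (B - 2 * k) .Min y') → ClearsWithin D g B .Min y := by
    intro B x y c v hc hxy hsub hB hall
    rw [← Nat.sub_add_cancel hB]
    refine ClearsWithin.of_burst hD hg.le v k y fun y' r hr0 hrs hrk hr => ?_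
    have hy' : D y' ⊆ D y := hD _ _ fun w hw => by
      have h1 := hr w hw
      have h2 := mul_nonneg hg.le (hr0 w)
      rw [hgk] at h1
      split_ifs at h1 <;> linarith
    have key : ∀ w ∈ D y', bump x v h w + h * (c w + r w / k) ≤ y' w := fun w hw => by
      have h1 := hr w hw
      have h2 := hxy w (hy' hw)
      have h3 : h * (r w / k) = g * r w := by rw [← hgk]; field_simp
      unfold bump
      rw [hgk] at h1
      rw [mul_add, h3]
      linarith
    refine hall y' (fun w => r w / k) (fun w => div_nonneg (hr0 w) hk'.le)
      (fun w hw => by simp [hrs w hw]) ?_ (hD _ _ fun w hw => ?_) key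
    · rw [← Finset.sum_div, hrk, div_self hk'.ne']
    · have h1 := key w hw
      have h2 := mul_nonneg hh.le (add_nonneg (hc w (hsub (hy' hw))) (div_nonneg (hr0 w) hk'.le))
      linarith
  have hpos : ∀ (S : Finset V) (c : V → ℝ), CupsBalanced (1 + H) S c →
      0 ≤ ∑ v ∈ S, (H + 1 - c v) := fun S c hc => Finset.sum_nonneg fun v hv => by
    have := hc.le hv
    linarith
  intro T
  induction T using Nat.twoStepInduction with
  | zero =>
    intro B x y c hx hc hc0 hxy hsub hB
    rw [show D x = ∅ from hx] at hsub
    exact .of_empty (Finset.subset_empty.mp hsub)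
  | one =>
    intro B x y c hx hc hc0 hxy hsub hB
    rcases hx with hx | ⟨v, -, hx⟩
    · rw [hx] at hsub
      exact .of_empty (Finset.subset_empty.mp hsub)
    have hB2 : 2 * k ≤ B := by
      have := mul_nonneg (mul_nonneg zero_le_two hk'.le) (hpos _ _ hc)
      have : (2 * k : ℝ) ≤ B := by push_cast at hB; linarith
      exact_mod_cast this
    refine burst B x y c v hc0 hxy hsub hB2 fun y' a _ _ _ hy' _ => ?_
    rw [show D (bump x v h) = ∅ from hx] at hy'
    exact .of_empty (Finset.subset_empty.mp hy')
  | more T ih _ =>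
    intro B x y c hx hc hc0 hxy hsub hB
    rcases hx with hx | ⟨v, -, hx⟩
    · rw [hx] at hsub
      exact .of_empty (Finset.subset_empty.mp hsub)
    have hΦ := mul_nonneg (mul_nonneg zero_le_two hk'.le) (hpos _ _ hc)
    push_cast at hB
    have hB2 : 2 * k ≤ B := by
      have : (2 * k : ℝ) ≤ B := by nlinarith [mul_nonneg hk'.le (Nat.cast_nonneg (α := ℝ) T)]
      exact_mod_cast this
    refine burst B x y c v hc0 hxy hsub hB2 fun y' a ha0 has ha1 hy' hxy' => ?_
    rcases hx with hx | hx
    · rw [hx] at hy'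
      exact .of_empty (Finset.subset_empty.mp hy')
    by_cases h0 : D (bump x v h) = ∅
    · rw [h0] at hy'
      exact .of_empty (Finset.subset_empty.mp hy')
    obtain ⟨m, hm, hmax⟩ := (D (bump x v h)).exists_max_image (fun w => c w + a w)
      (Finset.nonempty_iff_ne_empty.mpr h0)
    specialize hx m hm
    have hsx := hD.bump_subset x v hh.le
    have hsm := hD.bump_subset (bump x v h) m hh.le
    have hle : ∀ w ∈ D x, c w + a w ≤ H + 1 := fun w hw => by
      have h1 := hc.le hw
      have h2 := Finset.single_le_sum (fun i _ => ha0 i) (Finset.mem_univ w)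
      linarith
    have hsum : ∑ w ∈ D x, a w = 1 := by
      rw [← ha1]
      exact Finset.sum_subset (Finset.subset_univ _) fun w _ hw => has w fun h => hw (hsub h)
    have shrink : ∀ b : V → ℝ, (∀ w ∈ D x, b w ≤ H + 1) →
        ∑ w ∈ D (bump (bump x v h) m h), (H + 1 - b w) ≤ ∑ w ∈ D x, (H + 1 - b w) :=
      fun b hb => Finset.sum_le_sum_of_subset_of_nonneg (hsm.trans hsx) fun w hw _ => by
        linarith [hb w hw]
    -- With a full unit of credit at `m`, Max's imagined long move there is charged to it, and the
    -- total deficit does not grow.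
    by_cases hm1 : 1 ≤ c m + a m
    · have hc'0 : ∀ w ∈ D x, 0 ≤ c w + a w - if w = m then 1 else 0 := fun w hw => by
        have := add_nonneg (hc0 w hw) (ha0 w)
        split_ifs with e
        · subst e; linarith
        · linarith
      have hxy'' : ∀ w ∈ D y', bump (bump x v h) m h w
          + h * (c w + a w - if w = m then 1 else 0) ≤ y' w := fun w hw => by
        have := hxy' w hw
        rw [bump, mul_sub]
        split_ifs <;> linarith
      refine ih _ (bump (bump x v h) m h) y' (fun w => c w + a w - if w = m then 1 else 0) hx
        ((cupsBalanced_remove (hc.sum_add_le ha0 ha1.le) hsx hm hmax).subset hsm)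
        (fun w hw => hc'0 w (hsx (hsm hw))) hxy'' ?_ ?_
      · refine hD _ _ fun w hw => ?_
        have := mul_nonneg hh.le (hc'0 w (hsx (hy' hw)))
        linarith [hxy'' w hw]
      · have h1 := shrink (fun w => c w + a w - if w = m then 1 else 0) fun w hw => by
          have := hle w hw
          split_ifs <;> linarith
        have h2 : ∑ w ∈ D x, (H + 1 - (c w + a w - if w = m then 1 else 0))
            = ∑ w ∈ D x, (H + 1 - c w) := by
          simp only [Finset.sum_sub_distrib, Finset.sum_add_distrib, hsum, Finset.sum_ite_eq',
            hsx hm, if_true]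
          ring
        rw [h2] at h1
        rw [Nat.cast_sub hB2]
        push_cast
        nlinarith
    -- Otherwise Min pays for the imagined move at `m` by a second burst. Its `2 * k` extra turns
    -- are covered by the deficit, which the first burst lowered by one. All credits are at most 1,
    -- so balance is automatic.
    · have hlt : ∀ w ∈ D (bump x v h), c w + a w ≤ 1 := fun w hw =>
        (hmax w hw).trans (not_le.mp hm1).le
      have hbal : CupsBalanced (1 + H) (D (bump x v h)) fun w => c w + a w := fun A hA => by
        have h1 : ((harmonic A.card : ℚ) : ℝ) ≤ H := by
          rw [hH]
          exact_mod_cast harmonic_mono (Finset.card_le_univ A)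
        have h2 : ∑ w ∈ A, (c w + a w) ≤ A.card * 1 := by
          simpa using Finset.sum_le_card_nsmul A (fun w => c w + a w) 1 fun w hw => hlt w (hA hw)
        exact h2.trans (mul_le_mul_of_nonneg_left (by linarith) (Nat.cast_nonneg _))
      have hc'0 : ∀ w ∈ D x, 0 ≤ c w + a w := fun w hw => add_nonneg (hc0 w hw) (ha0 w)
      have h1 := shrink (fun w => c w + a w) hle
      have h2 : ∑ w ∈ D x, (H + 1 - (c w + a w)) = ∑ w ∈ D x, (H + 1 - c w) - 1 := by
        simp only [Finset.sum_sub_distrib, Finset.sum_add_distrib, hsum]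
        ring
      rw [h2] at h1
      have h3 := hpos _ _ (hbal.subset hsm)
      have hT : (0 : ℝ) ≤ k * T := by positivity
      have hB4 : 2 * k ≤ B - 2 * k := by
        have : ((2 * k : ℕ) : ℝ) ≤ ((B - 2 * k : ℕ) : ℝ) := by
          rw [Nat.cast_sub hB2]
          push_cast
          nlinarith
        exact_mod_cast this
      refine burst _ (bump x v h) y' (fun w => c w + a w) m (fun w hw => hc'0 w (hsx hw)) hxy' hy'
        hB4 fun y'' a' ha'0 _ _ hy'' hxy'' => ?_
      refine ih _ _ y'' (fun w => c w + a w) hx (hbal.subset hsm)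
        (fun w hw => hc'0 w (hsx (hsm hw))) (fun w hw => ?_) hy'' ?_
      · have := mul_nonneg hh.le (ha'0 w)
        have := hxy'' w hw
        linarith
      · rw [Nat.cast_sub hB4, Nat.cast_sub hB2]
        push_cast
        nlinarith

/-- Zero credit is balanced, and its deficit, at most `n * (L + 1)` with `n` the number of vertices,
bounds the cost of second bursts. -/
lemma clearsWithin_short (hD : IsDirtyMap D) (hg : 0 < g) (hk : 0 < k) (hgk : g * k = h)
    {L T : ℕ} (hL : (harmonic (Fintype.card V) : ℝ) ≤ L) (hT : ClearsWithin D h T .Min 0) :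
    ClearsWithin D g (k * (T + 1) + 2 * k * (Fintype.card V * (L + 1))) .Min 0 := by
  refine clearsWithin_short_of_credit hD hg hk hgk T _ 0 0 0 hT (fun A _ => ?_) (by simp)
    (by simp) subset_rfl ?_
  · have h1 : ((harmonic A.card : ℚ) : ℝ) ≤ harmonic (Fintype.card V) := by
      exact_mod_cast harmonic_mono (Finset.card_le_univ A)
    simp only [Pi.zero_apply, Finset.sum_const_zero]
    exact mul_nonneg (Nat.cast_nonneg _) (by linarith)
  · push_cast
    have h0 : (0 : ℝ) ≤ harmonic (Fintype.card V) := by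
      exact_mod_cast (harmonic_mono (Nat.zero_le _))
    have h1 : ((D 0).card : ℝ) ≤ Fintype.card V := by exact_mod_cast Finset.card_le_univ _
    simp only [Pi.zero_apply, sub_zero, Finset.sum_const, nsmul_eq_mul]
    gcongr

end Comparison

/-! ### Brushing as a placement game -/

section GraphGame

open scoped Classical

variable {V : Type*} (G : SimpleGraph V)

/-- The number of neighbours of `v` in `S`. -/
noncomputable def nbrsIn (S : Finset V) (v : V) : ℕ := (S.filter fun u => G.Adj v u).card

lemma nbrsIn_mono {S T : Finset V} (h : S ⊆ T) (v : V) : nbrsIn G S v ≤ nbrsIn G T v :=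
  Finset.card_le_card (Finset.filter_subset_filter _ h)

variable [Fintype V]

/-- No vertex of `S` can fire when `S` is the set of dirty vertices and `x v` is the number of
brushes placed on `v`, in units of `p`. -/
def IsStuck (x : V → ℝ) (S : Finset V) : Prop :=
  ∀ v ∈ S, x v + nbrsIn G Finset.univ v < 2 * nbrsIn G S v

/-- The largest stuck set. -/
noncomputable def dirtySet (x : V → ℝ) : Finset V :=
  Finset.univ.filter fun v => ∃ S, IsStuck G x S ∧ v ∈ S

variable {G}

lemma IsStuck.subset_dirtySet {x : V → ℝ} {S : Finset V} (hS : IsStuck G x S) :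
    S ⊆ dirtySet G x := fun v hv => by
  simpa [dirtySet] using ⟨S, hS, hv⟩

variable (G)

/-- Enlarging the set only adds dirty neighbours, so stuck sets are closed under union. -/
lemma isStuck_dirtySet (x : V → ℝ) : IsStuck G x (dirtySet G x) := by
  intro v hv
  obtain ⟨S, hS, hvS⟩ := (Finset.mem_filter.mp hv).2
  have h1 := hS v hvS
  have h2 : (nbrsIn G S v : ℝ) ≤ nbrsIn G (dirtySet G x) v := by
    exact_mod_cast nbrsIn_mono G hS.subset_dirtySet v
  linarith

lemma isDirtyMap_dirtySet : IsDirtyMap (dirtySet G) := fun _ y hxy =>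
  IsStuck.subset_dirtySet fun v hv =>
    (add_le_add_left (hxy v hv) _).trans_lt (isStuck_dirtySet G y v hv)

lemma dirtySet_zero_eq_empty (h : Fintype.card V ≤ 1) : dirtySet G 0 = ∅ := by
  refine Finset.eq_empty_of_forall_notMem fun v hv => ?_
  have h1 := isStuck_dirtySet G 0 v hv
  have h2 : nbrsIn G (dirtySet G 0) v = 0 := by
    have := Fintype.card_le_one_iff_subsingleton.mp h
    refine Finset.card_eq_zero.mpr (Finset.filter_eq_empty_iff.mpr fun u _ hu => ?_)
    exact hu.ne (Subsingleton.elim _ _)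
  rw [h2] at h1
  have : (0 : ℝ) ≤ nbrsIn G Finset.univ v := Nat.cast_nonneg _
  simp only [Pi.zero_apply] at h1
  push_cast at h1
  linarith

/-- The position `s` arises by firing some vertices after `p * x v` brushes have been placed on
each vertex `v`. -/
def Represents (p : ℝ) (x : V → ℝ) (s : BrushState V) : Prop :=
  dirtySet G x ⊆ s.dirty ∧ ∀ u ∈ s.dirty,
    s.brushes u = p * (x u + nbrsIn G Finset.univ u - nbrsIn G s.dirty u)

variable {G} {p : ℝ}

/-- A vertex of a stuck set cannot be the first of that set to fire. -/
lemma Represents.fire {x : V → ℝ} {s : BrushState V} (hp : 0 < p)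
    (hs : Represents G p x s) {v : V} (hv : s.Ready p G v) :
    Represents G p x (s.fire p G v) := by
  obtain ⟨hsub, hbr⟩ := hs
  obtain ⟨hvs, hv⟩ := hv
  refine ⟨fun u hu => Finset.mem_erase.mpr ⟨fun e => ?_, hsub hu⟩, fun u hu => ?_⟩
  · subst e
    have h1 := isStuck_dirtySet G x u hu
    have h2 : (nbrsIn G (dirtySet G x) u : ℝ) ≤ nbrsIn G s.dirty u := by
      exact_mod_cast nbrsIn_mono G hsub u
    rw [hbr u hvs] at hv
    have h3 : (nbrsIn G s.dirty u : ℝ) ≤ x u + nbrsIn G Finset.univ u - nbrsIn G s.dirty u :=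
      le_of_mul_le_mul_left hv hp
    linarith
  · obtain ⟨huv, hus⟩ := Finset.mem_erase.mp hu
    have hN : (s.fire p G v).dirty.filter (fun w => G.Adj u w)
        = (s.dirty.filter fun w => G.Adj u w).erase v := Finset.filter_erase _ _ _
    by_cases hadj : G.Adj v u
    · have hmem : v ∈ s.dirty.filter fun w => G.Adj u w :=
        Finset.mem_filter.mpr ⟨hvs, hadj.symm⟩
      have h1 : nbrsIn G (s.fire p G v).dirty u + 1 = nbrsIn G s.dirty u := by
        unfold nbrsIn
        rw [hN]
        exact Finset.card_erase_add_one hmem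
      have h2 : (nbrsIn G s.dirty u : ℝ) = nbrsIn G (s.fire p G v).dirty u + 1 := by
        exact_mod_cast h1.symm
      have h3 : (s.fire p G v).brushes u = s.brushes u + p := by
        simp [BrushState.fire, BrushState.dirtyNbrs, huv, hus, hadj]
      rw [h3, hbr u hus, h2]
      ring
    · have h1 : nbrsIn G (s.fire p G v).dirty u = nbrsIn G s.dirty u := by
        unfold nbrsIn
        rw [hN, Finset.erase_eq_of_notMem fun h => hadj (Finset.mem_filter.mp h).2.symm]
      have h3 : (s.fire p G v).brushes u = s.brushes u := by
        simp [BrushState.fire, BrushState.dirtyNbrs, huv, hadj]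
      rw [h3, hbr u hus, h1]

lemma Represents.stabilize (hp : 0 < p) {x : V → ℝ} (s : BrushState V)
    (hs : Represents G p x s) :
    Represents G p x (s.stabilize p G) ∧ (s.stabilize p G).dirty = dirtySet G x := by
  induction s using BrushState.stabilize.induct p G with
  | case1 s h ih =>
    rw [BrushState.stabilize, dif_pos h]
    exact ih (hs.fire hp h.choose_spec)
  | case2 s h =>
    rw [BrushState.stabilize, dif_neg h]
    refine ⟨hs, subset_antisymm (IsStuck.subset_dirtySet fun v hv => ?_) hs.1⟩
    have h1 : s.brushes v < p * (nbrsIn G s.dirty v : ℝ) := by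
      by_contra hc
      exact h ⟨v, hv, not_lt.mp hc⟩
    rw [hs.2 v hv] at h1
    have := lt_of_mul_lt_mul_left h1 hp.le
    linarith

lemma Represents.place (hp : 0 < p) {x : V → ℝ} {s : BrushState V} (hs : Represents G p x s)
    (v : V) : Represents G p (bump x v p⁻¹) (s.place v) := by
  refine ⟨((isDirtyMap_dirtySet G).bump_subset x v (by positivity)).trans hs.1, fun u hu => ?_⟩
  have h1 := hs.2 u hu
  change Function.update s.brushes v (s.brushes v + 1) u
    = p * (bump x v p⁻¹ u + nbrsIn G Finset.univ u - nbrsIn G s.dirty u)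
  unfold bump
  by_cases huv : u = v
  · subst huv
    simp only [Function.update_self, h1, if_true]
    field_simp
    ring
  · simp [huv, h1]

lemma endsWithin_iff_clearsWithin (hp : 0 < p) {k : ℕ} :
    ∀ {P : BrushPlayer} {x : V → ℝ} {s : BrushState V}, Represents G p x s →
      s.dirty = dirtySet G x →
      (EndsWithin p G k P s ↔ ClearsWithin (dirtySet G) p⁻¹ k P x) := by
  induction k with
  | zero =>
    intro P x s _ hd
    simp only [EndsWithin, ClearsWithin, hd]
  | succ k ih =>
    intro P x s hs hd
    have key : ∀ Q v, EndsWithin p G k Q (s.play p G v)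
        ↔ ClearsWithin (dirtySet G) p⁻¹ k Q (bump x v p⁻¹) := fun Q v =>
      have h := Represents.stabilize hp _ (hs.place hp v)
      ih h.1 h.2
    cases P <;> simp only [EndsWithin, ClearsWithin, hd, key]

lemma endsWithin_start_iff (hp : 0 < p) {k : ℕ} :
    EndsWithin p G k .Min (BrushState.start p G) ↔
      ClearsWithin (dirtySet G) p⁻¹ k .Min 0 := by
  have h : Represents G p 0 (⟨Finset.univ, fun _ => 0⟩ : BrushState V) :=
    ⟨Finset.subset_univ _, fun u _ => by simp⟩
  have h' := h.stabilize hp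
  exact endsWithin_iff_clearsWithin hp h'.1 h'.2

lemma fracGameBrushNumber_le (hp : 0 < p) {k : ℕ}
    (h : ClearsWithin (dirtySet G) p⁻¹ k .Min 0) : fracGameBrushNumber p G ≤ k :=
  Nat.sInf_le ((endsWithin_start_iff hp).mpr h)

/-! ### Comparing parameters -/

variable (G)

lemma clearsWithin_fracGameBrushNumber (hp : 0 < p) :
    ClearsWithin (dirtySet G) p⁻¹ (fracGameBrushNumber p G) .Min 0 :=
  (endsWithin_start_iff hp).mp (endsWithin_fracGameBrushNumber hp.le G)

lemma fracGameBrushNumber_mono {q : ℝ} (hp : 0 < p) (hpq : p ≤ q) :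
    fracGameBrushNumber p G ≤ fracGameBrushNumber q G :=
  fracGameBrushNumber_le hp <| .of_load_le (isDirtyMap_dirtySet G)
    (inv_nonneg.mpr (hp.trans_le hpq).le) (inv_anti₀ hp hpq) (fun _ _ => le_rfl)
    (clearsWithin_fracGameBrushNumber G (hp.trans_le hpq))

lemma fracGameBrushNumber_eq_zero (hp : 0 < p) (h : Fintype.card V ≤ 1) :
    fracGameBrushNumber p G = 0 :=
  Nat.le_zero.mp (fracGameBrushNumber_le hp (.of_empty (dirtySet_zero_eq_empty G h)))

/-- Multiplying the parameter by the integer `k` multiplies the length of the game by `k`, up to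
an error of `O(n L)` in units of `k`. -/
lemma fracGameBrushNumber_mul (hp : 0 < p) {k L : ℕ} (hk : 0 < k)
    (hL : (harmonic (Fintype.card V) : ℝ) ≤ L) :
    |k * (fracGameBrushNumber p G : ℝ) - fracGameBrushNumber (k * p) G|
      ≤ k * (2 * Fintype.card V * (L + 1) + 2) := by
  have hk' : (0 : ℝ) < k := by exact_mod_cast hk
  have hkp : 0 < k * p := mul_pos hk' hp
  have hg : (0 : ℝ) < (k * p)⁻¹ := inv_pos.mpr hkp
  have hgk : (k * p)⁻¹ * k = p⁻¹ := by field_simp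
  have hD := isDirtyMap_dirtySet G
  set n := Fintype.card V
  set B := fracGameBrushNumber (k * p) G
  have hup : (fracGameBrushNumber p G : ℝ) ≤ (B / k + 1 + 2 * n : ℕ) + 1 + 2 * n * L := by
    have hT : B + 2 * k * n ≤ k * (B / k + 1 + 2 * n) := by
      have := Nat.lt_mul_div_succ B hk
      nlinarith
    exact_mod_cast fracGameBrushNumber_le hp
      (clearsWithin_long hD hg hk hgk hL hT (clearsWithin_fracGameBrushNumber G hkp))
  have hlow : (B : ℝ) ≤ k * (fracGameBrushNumber p G + 1) + 2 * k * (n * (L + 1)) := by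
    exact_mod_cast fracGameBrushNumber_le hkp
      (clearsWithin_short hD hg hk hgk hL (clearsWithin_fracGameBrushNumber G hp))
  have hdiv : ((B / k : ℕ) : ℝ) * k ≤ B := by exact_mod_cast Nat.div_mul_le_self B k
  push_cast at hup
  have := mul_le_mul_of_nonneg_left hup hk'.le
  rw [abs_le]
  constructor <;> nlinarith

lemma fracGameBrushNumber_rat {q : ℚ} (hq : 0 < q) {L : ℕ}
    (hL : (harmonic (Fintype.card V) : ℝ) ≤ L) :
    |(fracGameBrushNumber (q : ℝ) G : ℝ) - q * gameBrushNumber G|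
      ≤ (1 + q) * (2 * Fintype.card V * (L + 1) + 2) := by
  have hb : (0 : ℝ) < q.den := by exact_mod_cast q.den_pos
  obtain ⟨a, ha⟩ : ∃ a : ℕ, (a : ℤ) = q.num :=
    ⟨q.num.toNat, Int.toNat_of_nonneg (Rat.num_pos.mpr hq).le⟩
  have ha0 : 0 < a := by
    have := Rat.num_pos.mpr hq
    omega
  have hqa : (q.den : ℝ) * q = a := by
    have h1 : (q.den : ℚ) * q = a := by
      rw [mul_comm, Rat.mul_den_eq_num, ← ha]
      simp
    exact_mod_cast h1
  have hq' : (0 : ℝ) < q := by exact_mod_cast hq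
  -- The numerator `a` is an integer multiple of both `q` and `1`.
  have h1 := fracGameBrushNumber_mul G hq' q.den_pos hL
  have h2 := fracGameBrushNumber_mul G one_pos ha0 hL
  rw [hqa] at h1
  rw [mul_one] at h2
  change |(a : ℝ) * (gameBrushNumber G : ℝ) - _| ≤ _ at h2
  set K : ℝ := 2 * Fintype.card V * (L + 1) + 2
  have h3 : |(q.den : ℝ) * ((fracGameBrushNumber (q : ℝ) G : ℝ) - q * gameBrushNumber G)|
      ≤ q.den * ((1 + q) * K) := by
    have e1 : (q.den : ℝ) * ((fracGameBrushNumber (q : ℝ) G : ℝ) - q * gameBrushNumber G)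
        = (q.den * (fracGameBrushNumber (q : ℝ) G : ℝ) - fracGameBrushNumber (a : ℝ) G)
          - (a * (gameBrushNumber G : ℝ) - fracGameBrushNumber (a : ℝ) G) := by
      rw [← hqa]
      ring
    have e2 : (q.den : ℝ) * ((1 + q) * K) = q.den * K + a * K := by
      rw [← hqa]
      ring
    rw [e1, e2]
    exact (abs_sub _ _).trans (add_le_add h1 h2)
  rw [abs_mul, abs_of_pos hb] at h3
  exact le_of_mul_le_mul_left h3 hb

lemma fracGameBrushNumber_sub_le (hp : 0 < p) {L : ℕ}
    (hL : (harmonic (Fintype.card V) : ℝ) ≤ L) :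
    |(fracGameBrushNumber p G : ℝ) - p * gameBrushNumber G|
      ≤ (1 + p) * (2 * Fintype.card V * (L + 1) + 2) := by
  set K : ℝ := 2 * Fintype.card V * (L + 1) + 2 with hK
  have hK0 : 0 ≤ K := by positivity
  set b : ℝ := (gameBrushNumber G : ℝ)
  have hb0 : 0 ≤ b := Nat.cast_nonneg _
  -- A rational within `δ` of `p` changes `p * b` and the error factor `(1 + p) * K` by at most `η`
  -- together.
  have close : ∀ η > 0, ∃ δ > 0, δ * (b + K) ≤ η := fun η hη =>
    ⟨η / (b + K + 1), by positivity, by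
      rw [div_mul_eq_mul_div, div_le_iff₀ (by positivity)]
      nlinarith⟩
  rw [abs_le]
  constructor
  · refine le_of_forall_pos_le_add fun η hη => ?_
    obtain ⟨δ, hδ, hδη⟩ := close η hη
    obtain ⟨q, hq1, hq2⟩ := exists_rat_btwn (show max 0 (p - δ) < p from max_lt hp (by linarith))
    have hq0 : (0 : ℝ) < q := (le_max_left _ _).trans_lt hq1
    have h1 := (abs_le.mp (fracGameBrushNumber_rat G (by exact_mod_cast hq0 : 0 < q) hL)).1
    have h2 : (fracGameBrushNumber (q : ℝ) G : ℝ) ≤ fracGameBrushNumber p G := by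
      exact_mod_cast fracGameBrushNumber_mono G hq0 hq2.le
    have h3 : p - δ < q := (le_max_right _ _).trans_lt hq1
    rw [← hK] at h1
    nlinarith
  · refine le_of_forall_pos_le_add fun η hη => ?_
    obtain ⟨δ, hδ, hδη⟩ := close η hη
    obtain ⟨q, hq1, hq2⟩ := exists_rat_btwn (show p < p + δ by linarith)
    have hq0 : (0 : ℝ) < q := hp.trans hq1
    have h1 := (abs_le.mp (fracGameBrushNumber_rat G (by exact_mod_cast hq0 : 0 < q) hL)).2
    have h2 : (fracGameBrushNumber p G : ℝ) ≤ fracGameBrushNumber (q : ℝ) G := by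
      exact_mod_cast fracGameBrushNumber_mono G hp hq1.le
    rw [← hK] at h1
    nlinarith

end GraphGame

theorem mainTheorem3 :
    ∃ (C : ℝ) (ε : ℕ → ℝ), Filter.Tendsto ε Filter.atTop (nhds 0) ∧
      ∀ (V : Type*) [Fintype V] (G : SimpleGraph V) (p : ℝ), 0 < p → p ≤ 1 →
        ∃ δ e : ℝ, |δ| ≤ ε (Fintype.card V) ∧
          |e| ≤ C * ((Fintype.card V : ℝ) * Real.log (Fintype.card V : ℝ)) ∧
          (fracGameBrushNumber p G : ℝ) = (1 + δ) * (p * (gameBrushNumber G : ℝ)) + e := by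
  -- the relative error is not needed: the bound holds with `δ = 0`
  refine ⟨32, fun _ => 0, tendsto_const_nhds, fun V _ G p hp hp1 =>
    ⟨0, (fracGameBrushNumber p G : ℝ) - p * gameBrushNumber G, by simp, ?_, by ring⟩⟩
  rcases Nat.lt_or_ge 1 (Fintype.card V) with hn | hn
  · have hn' : (2 : ℝ) ≤ Fintype.card V := by exact_mod_cast hn
    set n : ℝ := (Fintype.card V : ℝ)
    have hH := harmonic_le_one_add_log (Fintype.card V)
    have hlog : 1 / 2 ≤ Real.log n :=
      (by linarith [Real.log_two_gt_d9] : 1 / 2 ≤ Real.log 2).trans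
        (Real.log_le_log two_pos hn')
    have h1 := fracGameBrushNumber_sub_le G hp (hH.trans (Nat.le_ceil _))
    have h2 : ((⌈1 + Real.log n⌉₊ : ℕ) : ℝ) < 1 + Real.log n + 1 :=
      Nat.ceil_lt_add_one (by linarith)
    refine h1.trans ?_
    change (1 + p) * (2 * n * ((⌈1 + Real.log n⌉₊ : ℕ) + 1) + 2) ≤ 32 * (n * Real.log n)
    -- Since `ln n ≥ 1/2` and `n ≥ 2`, the terms `6 * n` and `2` are at most `12 * n * ln n` and `2
    -- * n * ln n`. The factor `1 + p ≤ 2` turns 16 into 32.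
    have h3 : 2 * n * (((⌈1 + Real.log n⌉₊ : ℕ) : ℝ) + 1) + 2 ≤ 16 * (n * Real.log n) := by
      have h4 : 2 * n * (((⌈1 + Real.log n⌉₊ : ℕ) : ℝ) + 1) ≤ 2 * n * (Real.log n + 3) :=
        mul_le_mul_of_nonneg_left (by linarith) (by linarith)
      nlinarith
    have h5 : 0 ≤ 16 * (n * Real.log n) := by positivity
    calc _ ≤ (1 + p) * (16 * (n * Real.log n)) :=
          mul_le_mul_of_nonneg_left h3 (by linarith)
      _ ≤ 32 * (n * Real.log n) := by nlinarith
  -- Here `n ln n = 0`, so the error must vanish exactly.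
  · have h1 : fracGameBrushNumber p G = 0 := fracGameBrushNumber_eq_zero G hp hn
    have h2 : gameBrushNumber G = 0 := fracGameBrushNumber_eq_zero G one_pos hn
    rw [h1, h2]
    have := Real.log_natCast_nonneg (Fintype.card V)
    simp only [Nat.cast_zero, mul_zero, sub_zero, abs_zero]
    positivity
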